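/- Let $m\ge 2$ be an integer, let $H_1,\dots,H_m$ be real Hilbert spaces, and let $\mathcal H=H_1\oplus\cdots\oplus H_m$ be their Hilbert direct sum, with scalar product $\langle\cdot,\cdot\rangle$ and norm $\|\cdot\|$. Let $f\colon\mathcal H\to\,]-\infty,+\infty]$ be proper, lower semicontinuous and convex. For every $i\in\{1,\dots,m\}$ let $g_i\colon\mathcal H\to\mathbb R$ be such that, for every $x=(x_1,\dots,x_m)\in\mathcal H$, the function $y\mapsto g_i(x_1,\dots,x_{i-1},y,x_{i+1},\dots,x_m)$ is convex and (Gâteaux) differentiable on $H_i$, and denote by $\nabla_i g_i(x)\in H_i$ its gradient at $x_i$. Suppose that, for all $x,y\in\mathcal H$, $$\sum_{i=1}^m\langle \nabla_i g_i(x)-\nabla_i g_i(y),\,x_i-y_i\rangle\ge 0 ,$$ and set $B\colon\mathcal H\to\mathcal H\colon x\mapsto(\nabla_1g_1(x),\dots,\nabla_mg_m(x))$. A single-valued operator is identified with the set-valued operator $x\mapsto\{Bx\}$. Terminology, for $A\colon\mathcal H\to2^{\mathcal H}$. Put $\operatorname{dom}A=\{x: Ax\ne\varnothing\}$, $\operatorname{ran}A=\bigcup_xAx$,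 $\operatorname{gra}A=\{(x,u):u\in Ax\}$, $\operatorname{zer}A=\{x:0\in Ax\}$; $A$ is surjective if $\operatorname{ran}A=\mathcal H$; sums of operators are pointwise Minkowski sums; $\partial f(x)=\{u:\forall y,\ \langle y-x,u\rangle+f(x)\le f(y)\}$. $A$ is monotone if $\langle x-y,u-v\rangle\ge0$ for all $(x,u),(y,v)\in\operatorname{gra}A$, and maximally monotone if, moreover, no monotone operator has a graph strictly containing $\operatorname{gra}A$. A monotone $A$ is $3^*$ monotone if, for all $x\in\operatorname{dom}A$ and $u\in\operatorname{ran}A$, $\langle x,u\rangle-\inf_{(y,v)\in\operatorname{gra}A}\langle x-y,u-v\rangle<+\infty$. A modulus is an increasing (i.e. nondecreasing) function $\phi\colon[0,+\infty[\,\to[0,+\infty]$ vanishing only at $0$; it is supercoercive if $\phi(t)/t\to+\infty$ as $t\to+\infty$. $A$ is uniformly monotone with modulus $\phi$ if $\langle x-y,u-v\rangle\ge\phi(\|x-y\|)$ for all $(x,u),(y,v)\in\operatorname{gra}A$. The function $f$ is uniformly convex with modulus $\phi$ if, for all $x,y$ with $f(x),f(y)<+\infty$ and all $\alpha\in\,]0,1[$,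 $f(\alpha x+(1-\alpha)y)+\alpha(1-\alpha)\phi(\|x-y\|)\le\alpha f(x)+(1-\alpha)f(y)$. **Proposition 3.2.** Suppose that $B$ is maximally monotone and that one of the following holds. 1. $\lim_{\|x\|\to+\infty}\inf\|\partial f(x)+Bx\|=+\infty$, where $\inf\|S\|=\inf_{u\in S}\|u\|$ and $\inf\|\varnothing\|=+\infty$. 2. $\partial f+B$ is uniformly monotone with a supercoercive modulus. 3. $(\operatorname{dom}\partial f)\cap\operatorname{dom}B$ is bounded. 4. $f=\iota_C$ (equal to $0$ on $C$ and $+\infty$ elsewhere), where $C$ is a nonempty closed convex bounded subset of $\mathcal H$. 5. $f$ is uniformly convex with a supercoercive modulus. 6. $B$ is $3^*$ monotone, and $\partial f$ or $B$ is surjective. 7. $B$ is uniformly monotone with a supercoercive modulus. 8. $B$ is linear and bounded, there exists $\beta\in\,]0,+\infty[$ such that $\langle x-y,Bx-By\rangle\ge\beta\|Bx-By\|^2$ for all $x,y\in\mathcal H$, and $\partial f$ or $B$ is surjective. Then $\operatorname{zer}(\partial f+B)\ne\varnothing$. In addition, if 2, 5, or 7 holds, $\operatorname{zer}(\partial f+B)$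 is a singleton. -/

import Mathlib

open Set Filter Topology
open scoped NNReal ENNReal Pointwise

noncomputable section

namespace NashMonotone

section Operators

variable {E : Type*} [NormedAddCommGroup E] [InnerProductSpace ℝ E]

/-- The domain of a set-valued operator `A : E → 2^E`. -/
def opDom (A : E → Set E) : Set E := {x | (A x).Nonempty}

/-- The range of a set-valued operator. -/
def opRan (A : E → Set E) : Set E := {u | ∃ x, u ∈ A x}

/-- The graph of a set-valued operator. -/
def opGraph (A : E → Set E) : Set (E × E) := {p | p.2 ∈ A p.1}

/-- The set of zeros of a set-valued operator. -/
def opZer (A : E → Set E) : Set E := {x | (0 : E) ∈ A x}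

/-- The pointwise (Minkowski) sum `x ↦ A x + B x = {u + v | u ∈ A x, v ∈ B x}`. -/
def opAdd (A B : E → Set E) : E → Set E := fun x => A x + B x

/-- A single-valued operator `T : E → E` regarded as the set-valued operator `x ↦ {T x}`. -/
def ofFun (T : E → E) : E → Set E := fun x => {T x}

/-- A set-valued operator is surjective if its range is the whole space. -/
def IsSurjective (A : E → Set E) : Prop := opRan A = univ

/-- Monotone set-valued operators. -/
def IsMonotone (A : E → Set E) : Prop :=
  ∀ x y : E, ∀ u ∈ A x, ∀ v ∈ A y, 0 ≤ inner ℝ (x - y) (u - v)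

/-- Maximally monotone operators: monotone, and equal to every monotone operator whose graph
contains the graph of `A`. -/
def IsMaximallyMonotone (A : E → Set E) : Prop :=
  IsMonotone A ∧ ∀ A' : E → Set E, IsMonotone A' → opGraph A ⊆ opGraph A' → A' = A

/-- The Fitzpatrick function
`F_A (x, u) = ⟪x, u⟫ - inf_{(y, v) ∈ gra A} ⟪x - y, u - v⟫`. -/
def fitzpatrick (A : E → Set E) (x u : E) : EReal :=
  ((inner ℝ x u : ℝ) : EReal) -
    ⨅ p ∈ opGraph A, ((inner ℝ (x - p.1) (u - p.2) : ℝ) : EReal)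

/-- `A` is `3*` monotone: `A` is monotone and `dom A × ran A ⊆ dom F_A`. -/
def IsThreeStarMonotone (A : E → Set E) : Prop :=
  IsMonotone A ∧ ∀ x ∈ opDom A, ∀ u ∈ opRan A, fitzpatrick A x u < ⊤

/-- Increasing functions `φ : [0, +∞[ → [0, +∞]` that vanish exactly at `0`. -/
def IsModulus (φ : ℝ≥0 → ℝ≥0∞) : Prop := Monotone φ ∧ ∀ t, φ t = 0 ↔ t = 0

/-- Supercoercivity: `φ t / t → +∞` as `t → +∞`. -/
def IsSupercoercive (φ : ℝ≥0 → ℝ≥0∞) : Prop :=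
  Tendsto (fun t : ℝ≥0 => φ t / (t : ℝ≥0∞)) atTop (𝓝 ⊤)

/-- `A` is uniformly monotone with modulus `φ`. -/
def IsUniformlyMonotoneWith (φ : ℝ≥0 → ℝ≥0∞) (A : E → Set E) : Prop :=
  IsModulus φ ∧ ∀ x y : E, ∀ u ∈ A x, ∀ v ∈ A y,
    ((φ ‖x - y‖₊ : ℝ≥0∞) : EReal) ≤ ((inner ℝ (x - y) (u - v) : ℝ) : EReal)

/-- `T : E → E` is `β`-cocoercive. -/
def IsCocoercive (β : ℝ) (T : E → E) : Prop :=
  ∀ x y : E, β * ‖T x - T y‖ ^ 2 ≤ inner ℝ (x - y) (T x - T y)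

/-- `inf_{u ∈ S} ‖u‖` with values in `[0, +∞]`; it is `+∞` when `S` is empty. -/
def infNorm (S : Set E) : ℝ≥0∞ := ⨅ u ∈ S, ‖u‖ₑ

/-- The coercivity condition `inf ‖A x‖ → +∞` as `‖x‖ → +∞`. -/
def IsCoerciveOp (A : E → Set E) : Prop :=
  Tendsto (fun x => infNorm (A x)) (comap (fun x : E => ‖x‖) atTop) (𝓝 ⊤)

end Operators

section Functions

variable {E : Type*} [NormedAddCommGroup E] [InnerProductSpace ℝ E]

/-- The class `Γ₀(E)` of proper lower semicontinuous convex functions `E → ]-∞, +∞]`. -/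
structure IsGammaZero (f : E → EReal) : Prop where
  ne_bot : ∀ x, f x ≠ ⊥
  proper : ∃ x, f x < ⊤
  lsc : LowerSemicontinuous f
  convex : ∀ x y : E, ∀ α : ℝ, 0 < α → α < 1 →
    f (α • x + (1 - α) • y) ≤ (α : EReal) * f x + ((1 - α : ℝ) : EReal) * f y

/-- The subdifferential of `f`. -/
def subdiff (f : E → EReal) : E → Set E := fun x =>
  {u | ∀ y : E, ((inner ℝ (y - x) u : ℝ) : EReal) + f x ≤ f y}

open Classical in
/-- The indicator function `ι_C`: `0` on `C` and `+∞` off `C`. -/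
def indicatorFun (C : Set E) : E → EReal := fun x => if x ∈ C then 0 else ⊤

/-- `f` is uniformly convex with modulus `φ`. -/
def IsUniformlyConvexWith (φ : ℝ≥0 → ℝ≥0∞) (f : E → EReal) : Prop :=
  IsModulus φ ∧ ∀ x y : E, f x < ⊤ → f y < ⊤ → ∀ α : ℝ, 0 < α → α < 1 →
    f (α • x + (1 - α) • y)
        + ((α * (1 - α) : ℝ) : EReal) * ((φ ‖x - y‖₊ : ℝ≥0∞) : EReal)
      ≤ (α : EReal) * f x + ((1 - α : ℝ) : EReal) * f y

/-- `u` is the (Gâteaux) gradient of `h` at `x`: every directional derivative of `h` at `x`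
exists, and the one along `v` equals `⟪u, v⟫`. -/
def HasGradAt (h : E → ℝ) (u x : E) : Prop :=
  ∀ v : E, HasLineDerivAt ℝ h (inner ℝ u v) x v

theorem HasGradAt.unique {h : E → ℝ} {u u' x : E} (hu : HasGradAt h u x)
    (hu' : HasGradAt h u' x) : u = u' :=
  ext_inner_right ℝ fun v => (hu v).unique (hu' v)

/-- `h` is (Gâteaux) differentiable at `x`. -/
def IsDiffAt (h : E → ℝ) (x : E) : Prop := ∃ u, HasGradAt h u x

open Classical in
/-- The gradient of `h` at `x` (with value `0` where `h` is not differentiable). -/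
def grad (h : E → ℝ) (x : E) : E := if H : IsDiffAt h x then H.choose else 0

theorem IsDiffAt.hasGradAt {h : E → ℝ} {x : E} (H : IsDiffAt h x) :
    HasGradAt h (grad h x) x := by
  rw [grad, dif_pos H]
  exact H.choose_spec

end Functions

section Game

variable {m : ℕ} {H : Fin m → Type*} [∀ i, NormedAddCommGroup (H i)]
  [∀ i, InnerProductSpace ℝ (H i)]

/-- The function `y ↦ h (x₁, …, x_{i-1}, y, x_{i+1}, …, x_m)` on `H i`. The Hilbert direct sum
`H₁ ⊕ ⋯ ⊕ H_m` is `PiLp 2 H`. -/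
def slice (h : PiLp 2 H → ℝ) (i : Fin m) (x : PiLp 2 H) : H i → ℝ :=
  fun y => h (WithLp.toLp 2 (Function.update x.ofLp i y))

/-- The partial gradient `∇ᵢ h (x)`: the gradient at `x i` of the `i`-th slice through `x`. -/
def partialGrad (h : PiLp 2 H → ℝ) (i : Fin m) (x : PiLp 2 H) : H i :=
  grad (slice h i x) (x i)

/-- The operator `B : x ↦ (∇₁ g₁ (x), …, ∇_m g_m (x))`. -/
def pseudoGrad (g : Fin m → PiLp 2 H → ℝ) (x : PiLp 2 H) : PiLp 2 H :=
  WithLp.toLp 2 fun i => partialGrad (g i) i x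

end Game

end NashMonotone

end

open NashMonotone

/-!
A zero of `∂f + T`, where `T` is the operator `B` of the game, is a solution `x` of the variational
inequality `f x + ⟪T x, x - y⟫ ≤ f y` for all `y`. Since `T` is maximally monotone, single-valued
and defined everywhere, this inequality can be solved directly, without the general theory of sums
of maximally monotone operators.

By Minty's lemma (`IsGammaZero.neg_smul_mem_of_minty`), `T x` may be replaced by `T y` in the
inequality, because `T` is hemicontinuous (`IsMaximallyMonotone.le_inner_of_segment`). For fixed `y`
the new inequality cuts out a closed convex set of points `x`. With `f + (ε / 2) ‖·‖ ^ 2` in place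
of `f`, finitely many of these sets always meet: this is a finite minimax statement
(`exists_mem_stdSimplex_forall_sum_le_zero`), in which monotonicity of `T` gives the sign of the
symmetric part of the payoff matrix. The quadratic term provides boundedness, so by weak compactness
all the sets meet, and every regularization `∂f + T + ε Id` with `ε > 0` has a zero
(`IsGammaZero.exists_regularized_zero`).

A second weak limit, as `ε ↓ 0`, produces a zero of `∂f + T` whenever the regularized zeros stay
bounded (`IsGammaZero.nonempty_opZer_of_bounded`). Monotonicity always bounds `ε x` along
regularized zeros `x`, so coercivity or uniform monotonicity with a supercoercive modulus bounds `x`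
itself. Uniform convexity of `f` makes `∂f` uniformly monotone. When `T` is `3*` monotone and one of
the two operators is surjective, the Brezis–Haraux argument bounds `⟪x, w⟫` for every fixed `w`, and
the uniform boundedness principle bounds `x`; cocoercive operators are `3*` monotone.
-/

namespace NashMonotone

/-! ### A finite minimax lemma and two functional-analytic principles -/

/-- A matrix game whose payoff has nonpositive symmetric part has value at most `0`. If no mixed
strategy `w` makes `M w` nonpositive, a hyperplane separating the image of the simplex from the
nonpositive orthant gives a strategy `μ` with `μᵀ M w > 0` for every `w`, and `w = μ` contradicts
the sign of the symmetric part. -/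
theorem exists_mem_stdSimplex_forall_sum_le_zero {ι : Type*} [Fintype ι] [Nonempty ι]
    (M : ι → ι → ℝ) (hM : ∀ i j, M i j + M j i ≤ 0) :
    ∃ w ∈ stdSimplex ℝ ι, ∀ i, ∑ j, w j * M i j ≤ 0 := by
  classical
  by_contra! hcon
  let L : (ι → ℝ) →ₗ[ℝ] (ι → ℝ) := Matrix.mulVecLin (Matrix.of M)
  have hL : ∀ w i, L w i = ∑ j, w j * M i j := fun w i => by
    simp [L, Matrix.mulVec, dotProduct, mul_comm]
  have hdisj : Disjoint (L '' stdSimplex ℝ ι) {v | ∀ i, v i ≤ 0} := by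
    rw [Set.disjoint_left]
    rintro _ ⟨w, hw, rfl⟩ hle
    obtain ⟨i, hi⟩ := hcon w hw
    have := hle i
    rw [hL] at this
    linarith
  have hclosed : IsClosed {v : ι → ℝ | ∀ i, v i ≤ 0} := by
    simp only [ofPred_forall]
    exact isClosed_iInter fun i => isClosed_le (continuous_apply i) continuous_const
  have hconv : Convex ℝ {v : ι → ℝ | ∀ i, v i ≤ 0} := by
    intro v hv w hw a b ha hb _ i
    have h1 := mul_nonpos_of_nonneg_of_nonpos ha (hv i)
    have h2 := mul_nonpos_of_nonneg_of_nonpos hb (hw i)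
    simpa using add_nonpos h1 h2
  obtain ⟨l, a, b, hla, hab, hlb⟩ := geometric_hahn_banach_compact_closed
    ((convex_stdSimplex ℝ ι).linear_image L)
    ((isCompact_stdSimplex ℝ ι).image (LinearMap.continuous_of_finiteDimensional L))
    hconv hclosed hdisj
  have hb0 : b < 0 := by simpa using hlb 0 (by simp)
  let μ : ι → ℝ := fun i => -l (Pi.single i 1)
  have hlμ : ∀ v, l v = -∑ i, μ i * v i := by
    intro v
    conv_lhs => rw [← Finset.univ_sum_single v]
    rw [map_sum, ← Finset.sum_neg_distrib]
    refine Finset.sum_congr rfl fun i _ => ?_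
    have : (Pi.single i (v i) : ι → ℝ) = v i • Pi.single i 1 := by
      rw [← Pi.single_smul]; simp
    rw [this, map_smul]
    simp [μ, mul_comm]
  have hμ : ∀ i, 0 ≤ μ i := by
    intro i
    by_contra! hneg
    -- `l` is bounded below on the ray spanned by `-eᵢ`, on which it is `s ↦ s * μ i`
    have key := hlb (Pi.single i (-(b / μ i))) (fun j => by
      by_cases hj : j = i
      · subst hj
        simpa using div_nonneg_of_nonpos hb0.le hneg.le
      · simp [hj])
    rw [hlμ] at key
    have : ∑ j, μ j * (Pi.single i (-(b / μ i)) : ι → ℝ) j = -b := by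
      simp [Pi.single_apply, mul_div_cancel₀ _ hneg.ne]
    rw [this] at key
    linarith
  have hpos : ∀ w ∈ stdSimplex ℝ ι, 0 < ∑ i, μ i * L w i := by
    intro w hw
    have := hla _ ⟨w, hw, rfl⟩
    rw [hlμ] at this
    linarith
  have hs : 0 < ∑ i, μ i := by
    refine (Finset.sum_nonneg fun i _ => hμ i).lt_of_ne fun h0 => ?_
    have hz : ∀ i, μ i = 0 := fun i =>
      (Finset.sum_eq_zero_iff_of_nonneg fun i _ => hμ i).1 h0.symm i (Finset.mem_univ i)
    obtain ⟨i₀⟩ := ‹Nonempty ι›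
    simpa [hz] using hpos _ (single_mem_stdSimplex ℝ i₀)
  have h1 := hpos ((∑ i, μ i)⁻¹ • μ) ⟨fun i => by
    simpa using mul_nonneg (inv_nonneg.2 hs.le) (hμ i), by
    simp only [Pi.smul_apply, smul_eq_mul]
    rw [← Finset.mul_sum, inv_mul_cancel₀ hs.ne']⟩
  rw [map_smul] at h1
  have h2 : 0 < ∑ i, μ i * L μ i := by
    have : ∑ i, μ i * ((∑ i, μ i)⁻¹ • L μ) i = (∑ i, μ i)⁻¹ * ∑ i, μ i * L μ i := by
      rw [Finset.mul_sum]
      refine Finset.sum_congr rfl fun i _ => ?_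
      simp; ring
    rw [this] at h1
    exact (pos_iff_pos_of_mul_pos h1).1 (inv_pos.2 hs)
  have h3 : ∑ i, μ i * L μ i = ∑ i, ∑ j, μ i * μ j * M i j := by
    refine Finset.sum_congr rfl fun i _ => ?_
    rw [hL, Finset.mul_sum]
    exact Finset.sum_congr rfl fun j _ => by ring
  have h4 : ∑ i, ∑ j, μ i * μ j * M i j = ∑ i, ∑ j, μ i * μ j * M j i := by
    rw [Finset.sum_comm]
    exact Finset.sum_congr rfl fun i _ => Finset.sum_congr rfl fun j _ => by ring
  have h5 : ∑ i, ∑ j, μ i * μ j * (M i j + M j i) ≤ 0 :=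
    Finset.sum_nonpos fun i _ => Finset.sum_nonpos fun j _ =>
      mul_nonpos_of_nonneg_of_nonpos (mul_nonneg (hμ i) (hμ j)) (hM i j)
  simp only [mul_add, Finset.sum_add_distrib] at h5
  linarith

section

variable {E : Type*} [NormedAddCommGroup E] [InnerProductSpace ℝ E] {T : E → E}

theorem IsMonotone.inner_nonneg (hT : IsMonotone (ofFun T)) (x y : E) :
    0 ≤ inner ℝ (x - y) (T x - T y) :=
  hT x y _ rfl _ rfl

/-- Maximality of a single-valued operator, tested on points: the graph of `T` cannot be enlarged
by `(x, u)` without losing monotonicity unless `u = T x`. -/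
theorem IsMaximallyMonotone.eq_of_forall_inner_nonneg (hT : IsMaximallyMonotone (ofFun T))
    {x u : E} (h : ∀ z, 0 ≤ inner ℝ (x - z) (u - T z)) : u = T x := by
  let A : E → Set E := fun y => {v | v = T y ∨ (y = x ∧ v = u)}
  have hA : IsMonotone A := by
    rintro y z v (rfl | ⟨rfl, rfl⟩) w (rfl | ⟨rfl, rfl⟩)
    · exact hT.1.inner_nonneg _ _
    · rw [← neg_sub, ← neg_sub w, inner_neg_neg]
      exact h y
    · exact h z
    · simp
  have hAT : A = ofFun T := hT.2 A hA fun p hp => Or.inl hp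
  have : u ∈ A x := Or.inr ⟨rfl, rfl⟩
  rw [hAT] at this
  exact this

variable [CompleteSpace E]

/-- A bounded family in a Hilbert space has a weak cluster point: a point lying in every closed
convex set in which the family eventually stays. -/
theorem exists_forall_mem_of_eventually_norm_le {ι : Type*} {l : Filter ι} [l.NeBot] {x : ι → E}
    {M : ℝ} (hx : ∀ᶠ i in l, ‖x i‖ ≤ M) :
    ∃ u, ∀ C : Set E, Convex ℝ C → IsClosed C → (∀ᶠ i in l, x i ∈ C) → u ∈ C := by
  let y : ι → WeakDual ℝ E := fun i => StrongDual.toWeakDual (InnerProductSpace.toDual ℝ E (x i))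
  have hy : ∀ i z, y i z = inner ℝ (x i) z := fun i z => rfl
  obtain ⟨φ, -, hφ⟩ := (WeakDual.isCompact_closedBall (𝕜 := ℝ) (E := E) 0 M).exists_mapClusterPt
    (f := l) (u := y) (by
      rw [Filter.le_principal_iff, Filter.mem_map]
      filter_upwards [hx] with i hi
      have : WeakDual.toStrongDual (y i) = InnerProductSpace.toDual ℝ E (x i) := rfl
      simpa [this] using hi)
  refine ⟨(InnerProductSpace.toDual ℝ E).symm (WeakDual.toStrongDual φ),
    fun C hC hCc hev => ?_⟩
  by_contra hu
  obtain ⟨p, s, hps, hpC⟩ := geometric_hahn_banach_point_closed hC hCc hu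
  set z := (InnerProductSpace.toDual ℝ E).symm p
  have hp : ∀ v, p v = inner ℝ v z := fun v => by
    rw [real_inner_comm, InnerProductSpace.toDual_symm_apply]
  have hφz : φ z < s := by
    rw [hp, InnerProductSpace.toDual_symm_apply] at hps
    exact hps
  have hopen : {ψ : WeakDual ℝ E | ψ z < s} ∈ 𝓝 φ :=
    (isOpen_lt (WeakDual.eval_continuous z) continuous_const).mem_nhds hφz
  obtain ⟨i, hi, hiC⟩ := ((mapClusterPt_iff_frequently.1 hφ _ hopen).and_eventually hev).exists
  have h1 := hpC _ hiC
  have h2 : y i z < s := hi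
  rw [hp] at h1
  rw [hy] at h2
  linarith

/-- One-sided uniform boundedness principle. -/
theorem exists_forall_norm_le_of_forall_inner_le {ι : Type*} {a : ι → E}
    (h : ∀ w, ∃ C : ℝ, ∀ i, inner ℝ (a i) w ≤ C) : ∃ C : ℝ, ∀ i, ‖a i‖ ≤ C := by
  obtain ⟨C, hC⟩ := banach_steinhaus (g := fun i => innerSL ℝ (a i)) (fun w => by
    obtain ⟨C₁, h₁⟩ := h w
    obtain ⟨C₂, h₂⟩ := h (-w)
    refine ⟨max C₁ C₂, fun i => ?_⟩
    have h₃ := h₂ i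
    rw [inner_neg_right] at h₃
    rw [innerSL_apply_apply, Real.norm_eq_abs, abs_le]
    constructor
    · linarith [le_max_right C₁ C₂]
    · exact (h₁ i).trans (le_max_left _ _))
  exact ⟨C, fun i => by simpa using hC i⟩

/-! ### Hemicontinuity of single-valued maximally monotone operators -/

/-- A monotone operator defined everywhere is bounded along a segment near its starting point,
by uniform boundedness applied to the values rescaled by `1 + ‖T (x + t h)‖ * (t * ‖h‖)`. -/
theorem IsMonotone.exists_norm_le_on_segment (hT : IsMonotone (ofFun T)) (x h : E) :
    ∃ C : ℝ, ∀ᶠ t : ℝ in 𝓝[>] 0, ‖T (x + t • h)‖ ≤ C := by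
  let c : Ioc (0 : ℝ) 1 → ℝ := fun t => 1 + ‖T (x + t.1 • h)‖ * (t.1 * ‖h‖)
  have hc : ∀ t, 1 ≤ c t := fun t => by
    have := mul_nonneg (norm_nonneg (T (x + t.1 • h))) (mul_nonneg t.2.1.le (norm_nonneg h))
    simp only [c]
    linarith
  obtain ⟨C, hC⟩ := exists_forall_norm_le_of_forall_inner_le
    (a := fun t : Ioc (0 : ℝ) 1 => (c t)⁻¹ • T (x + t.1 • h)) (fun z => by
      refine ⟨1 + ‖T (x + z)‖ * (‖h‖ + ‖z‖), fun t => ?_⟩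
      have hct : 0 < c t := one_pos.trans_le (hc t)
      rw [real_inner_smul_left, inv_mul_le_iff₀ hct]
      have hmon := hT.inner_nonneg (x + t.1 • h) (x + z)
      rw [show x + t.1 • h - (x + z) = t.1 • h - z by abel, inner_sub_right, inner_sub_left,
        real_inner_comm _ z] at hmon
      have hn : ‖t.1 • h‖ = t.1 * ‖h‖ := by rw [norm_smul, Real.norm_of_nonneg t.2.1.le]
      have h1 : inner ℝ (t.1 • h) (T (x + t.1 • h)) ≤ c t := by
        have := real_inner_le_norm (t.1 • h) (T (x + t.1 • h))
        rw [hn] at this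
        simp only [c]
        linarith
      have h2 : -inner ℝ (t.1 • h - z) (T (x + z)) ≤ ‖T (x + z)‖ * (‖h‖ + ‖z‖) := by
        have h3 := (abs_le.1 (abs_real_inner_le_norm (t.1 • h - z) (T (x + z)))).1
        have h4 : ‖t.1 • h - z‖ ≤ ‖h‖ + ‖z‖ := by
          refine (norm_sub_le _ _).trans (add_le_add_left ?_ _)
          rw [hn]
          exact mul_le_of_le_one_left (norm_nonneg h) t.2.2
        have h5 := mul_le_mul_of_nonneg_right h4 (norm_nonneg (T (x + z)))
        linarith
      have h6 : 0 ≤ ‖T (x + z)‖ * (‖h‖ + ‖z‖) := by positivity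
      have h7 := mul_le_mul_of_nonneg_right (hc t) h6
      linarith)
  refine ⟨2 * C, ?_⟩
  have hC0 : 0 ≤ C := (norm_nonneg _).trans (hC ⟨1, one_pos, le_rfl⟩)
  have hδ : (0 : ℝ) < min 1 (1 / (2 * (C * ‖h‖ + 1))) := by positivity
  filter_upwards [Ioc_mem_nhdsGT hδ] with t ht
  have ht1 : t ≤ 1 := ht.2.trans (min_le_left _ _)
  have ht2 : t * (2 * (C * ‖h‖ + 1)) ≤ 1 :=
    (le_div_iff₀ (by positivity)).1 (ht.2.trans (min_le_right _ _))
  have hct := hc ⟨t, ht.1, ht1⟩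
  have key := hC ⟨t, ht.1, ht1⟩
  simp only at key
  rw [norm_smul, norm_inv, Real.norm_of_nonneg (zero_le_one.trans hct),
    inv_mul_le_iff₀ (one_pos.trans_le hct)] at key
  simp only [c] at key
  have h8 : C * (‖h‖ * t) ≤ 1 / 2 := by nlinarith [ht.1]
  have h9 := mul_le_mul_of_nonneg_right h8 (norm_nonneg (T (x + t • h)))
  nlinarith

/-- Hemicontinuity of a single-valued maximally monotone operator, in the form used below: an
asymptotic lower bound for `⟪T (x + t h), h⟫` as `t ↓ 0` passes to `⟪T x, h⟫`. The values along
the segment have a weak cluster point, which maximality identifies with `T x`. -/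
theorem IsMaximallyMonotone.le_inner_of_segment (hT : IsMaximallyMonotone (ofFun T))
    {x h : E} {r k : ℝ} (hr : ∀ t ∈ Ioc (0 : ℝ) 1, r - k * t ≤ inner ℝ (T (x + t • h)) h) :
    r ≤ inner ℝ (T x) h := by
  obtain ⟨C, hC⟩ := hT.1.exists_norm_le_on_segment x h
  obtain ⟨u, hu⟩ := exists_forall_mem_of_eventually_norm_le hC
  have half : ∀ (p : E) (s : ℝ),
      (∀ᶠ t : ℝ in 𝓝[>] 0, s ≤ inner ℝ p (T (x + t • h))) → s ≤ inner ℝ p u := fun p s hs =>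
    hu {v | s ≤ inner ℝ p v} (convex_halfSpace_ge (innerSL ℝ p).isLinear s)
      (isClosed_le continuous_const (by fun_prop)) hs
  have hTx : u = T x := by
    refine hT.eq_of_forall_inner_nonneg fun z => ?_
    rw [inner_sub_right, sub_nonneg]
    refine le_of_forall_sub_le fun δ hδ => half _ _ ?_
    have hδ' : 0 < δ / (‖h‖ * (C + ‖T z‖ + 1) + 1) := by
      have : 0 ≤ C := by
        obtain ⟨t, ht⟩ := hC.exists
        exact (norm_nonneg _).trans ht
      positivity
    filter_upwards [hC, Ioc_mem_nhdsGT hδ'] with t ht htδ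
    have hmon := hT.1.inner_nonneg (x + t • h) z
    rw [show x + t • h - z = (x - z) + t • h by abel, inner_add_left, real_inner_smul_left,
      inner_sub_right] at hmon
    have hC0 : 0 ≤ C := (norm_nonneg _).trans ht
    have h1 : inner ℝ h (T (x + t • h) - T z) ≤ ‖h‖ * (C + ‖T z‖ + 1) + 1 := by
      refine (real_inner_le_norm _ _).trans ?_
      have h2 := norm_sub_le (T (x + t • h)) (T z)
      have h3 : ‖T (x + t • h) - T z‖ ≤ C + ‖T z‖ + 1 := by linarith
      linarith [mul_le_mul_of_nonneg_left h3 (norm_nonneg h)]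
    have h4 := mul_le_mul_of_nonneg_left h1 htδ.1.le
    have h5 : t * (‖h‖ * (C + ‖T z‖ + 1) + 1) ≤ δ := (le_div_iff₀ (by positivity)).1 htδ.2
    linarith
  rw [← hTx, real_inner_comm]
  refine le_of_forall_sub_le fun δ hδ => half _ _ ?_
  have hδ' : 0 < δ / (|k| + 1) := by positivity
  filter_upwards [Ioc_mem_nhdsGT (lt_min hδ' one_pos)] with t ht
  have h1 := hr t ⟨ht.1, ht.2.trans (min_le_right _ _)⟩
  rw [real_inner_comm] at h1
  have h2 : t * (|k| + 1) ≤ δ :=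
    (le_div_iff₀ (by positivity)).1 (ht.2.trans (min_le_left _ _))
  have h3 : k * t ≤ |k| * t := mul_le_mul_of_nonneg_right (le_abs_self k) ht.1.le
  linarith [ht.1]

end

section

/-! ### Proper lower semicontinuous convex functions in real terms -/

variable {E : Type*} [NormedAddCommGroup E] [InnerProductSpace ℝ E] {f : E → EReal}

theorem IsGammaZero.coe_toReal (hf : IsGammaZero f) {x : E} (hx : f x < ⊤) :
    ((f x).toReal : EReal) = f x :=
  EReal.coe_toReal hx.ne (hf.ne_bot x)

theorem IsGammaZero.mem_subdiff_iff (hf : IsGammaZero f) {x u : E} :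
    u ∈ subdiff f x ↔ f x < ⊤ ∧
      ∀ y, f y < ⊤ → inner ℝ (y - x) u + (f x).toReal ≤ (f y).toReal := by
  constructor
  · intro hu
    obtain ⟨p, hp⟩ := hf.proper
    have hx : f x < ⊤ := by
      by_contra h
      have h1 := hu p
      rw [not_lt_top_iff.1 h, EReal.coe_add_top] at h1
      exact absurd hp (not_lt.2 h1)
    refine ⟨hx, fun y hy => ?_⟩
    have h1 := hu y
    rw [← hf.coe_toReal hx, ← hf.coe_toReal hy] at h1
    exact_mod_cast h1
  · rintro ⟨hx, h⟩ y
    by_cases hy : f y < ⊤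
    · rw [← hf.coe_toReal hx, ← hf.coe_toReal hy]
      exact_mod_cast h y hy
    · rw [not_lt_top_iff.1 hy]
      exact le_top

theorem IsGammaZero.isMonotone_subdiff (hf : IsGammaZero f) : IsMonotone (subdiff f) := by
  intro x y u hu v hv
  rw [hf.mem_subdiff_iff] at hu hv
  have h1 := hu.2 y hv.1
  have h2 := hv.2 x hu.1
  rw [← neg_sub, inner_neg_left] at h1
  rw [inner_sub_right]
  linarith

theorem IsGammaZero.convexOn_toReal (hf : IsGammaZero f) :
    ConvexOn ℝ {x | f x < ⊤} fun x => (f x).toReal := by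
  have key : ∀ x y, f x < ⊤ → f y < ⊤ → ∀ a : ℝ, 0 < a → a < 1 →
      f (a • x + (1 - a) • y) ≤ ((a * (f x).toReal + (1 - a) * (f y).toReal : ℝ) : EReal) := by
    intro x y hx hy a h0 h1
    have := hf.convex x y a h0 h1
    rw [← hf.coe_toReal hx, ← hf.coe_toReal hy] at this
    exact_mod_cast this
  rw [convexOn_iff_forall_pos]
  refine ⟨convex_iff_forall_pos.2 fun x hx y hy a b ha hb hab => ?_,
    fun x hx y hy a b ha hb hab => ?_⟩ <;>
  obtain rfl : b = 1 - a := by linarith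
  · exact (key x y hx hy a ha (by linarith)).trans_lt (EReal.coe_lt_top _)
  · have h := key x y hx hy a ha (by linarith)
    exact_mod_cast (hf.coe_toReal (h.trans_lt (EReal.coe_lt_top _))).le.trans h

theorem convexOn_norm_sq {s : Set E} (hs : Convex ℝ s) : ConvexOn ℝ s fun x => ‖x‖ ^ 2 :=
  (convexOn_norm hs).pow (fun x _ => norm_nonneg x) 2

theorem IsGammaZero.convexOn_add_sq (hf : IsGammaZero f) {ε : ℝ} (hε : 0 ≤ ε) :
    ConvexOn ℝ {x | f x < ⊤} fun x => (f x).toReal + ε / 2 * ‖x‖ ^ 2 :=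
  hf.convexOn_toReal.add
    ((convexOn_norm_sq hf.convexOn_toReal.1).smul (show (0 : ℝ) ≤ ε / 2 by positivity))

theorem IsGammaZero.convex_sublevel (hf : IsGammaZero f) {ε : ℝ} (hε : 0 ≤ ε) (p : E) (c : ℝ) :
    Convex ℝ {x | f x < ⊤ ∧ (f x).toReal + ε / 2 * ‖x‖ ^ 2 + inner ℝ p x ≤ c} :=
  ((hf.convexOn_add_sq hε).add
    ((innerSL ℝ p).toLinearMap.convexOn hf.convexOn_toReal.1)).convex_le c

theorem IsGammaZero.isClosed_sublevel (hf : IsGammaZero f) (ε : ℝ) (p : E) (c : ℝ) :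
    IsClosed {x | f x < ⊤ ∧ (f x).toReal + ε / 2 * ‖x‖ ^ 2 + inner ℝ p x ≤ c} := by
  have : {x | f x < ⊤ ∧ (f x).toReal + ε / 2 * ‖x‖ ^ 2 + inner ℝ p x ≤ c} =
      (fun x => (x, ((c - ε / 2 * ‖x‖ ^ 2 - inner ℝ p x : ℝ) : EReal))) ⁻¹'
        {q : E × EReal | f q.1 ≤ q.2} := by
    ext x
    simp only [mem_ofPred_eq, mem_preimage]
    constructor
    · rintro ⟨hx, h⟩
      rw [← hf.coe_toReal hx, EReal.coe_le_coe_iff]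
      linarith
    · intro h
      have hx := h.trans_lt (EReal.coe_lt_top _)
      rw [← hf.coe_toReal hx, EReal.coe_le_coe_iff] at h
      exact ⟨hx, by linarith⟩
  rw [this]
  refine hf.lsc.isClosed_epigraph.preimage (continuous_id.prodMk ?_)
  exact continuous_coe_real_ereal.comp (by fun_prop)

/-- A proper lower semicontinuous convex function decreases at most linearly: lower semicontinuity
bounds it below near a point of its domain, and convexity propagates the bound along rays. -/
theorem IsGammaZero.exists_linear_lower_bound (hf : IsGammaZero f) {p : E} (hp : f p < ⊤) :
    ∃ K : ℝ, 0 ≤ K ∧ ∀ x, f x < ⊤ → (f p).toReal - 1 - K * ‖x - p‖ ≤ (f x).toReal := by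
  have hlt : (((f p).toReal - 1 : ℝ) : EReal) < f p := by
    conv_rhs => rw [← hf.coe_toReal hp]
    exact_mod_cast sub_one_lt _
  obtain ⟨r, hr, hball⟩ := Metric.eventually_nhds_iff.1 (hf.lsc p _ hlt)
  have near : ∀ z, f z < ⊤ → ‖z - p‖ < r → (f p).toReal - 1 < (f z).toReal := by
    intro z hz hzr
    have : (((f p).toReal - 1 : ℝ) : EReal) < f z := hball (by rwa [dist_eq_norm])
    rw [← hf.coe_toReal hz] at this
    exact_mod_cast this
  refine ⟨2 / r, by positivity, fun x hx => ?_⟩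
  rcases lt_or_ge ‖x - p‖ r with hxr | hxr
  · have : 0 ≤ 2 / r * ‖x - p‖ := by positivity
    linarith [near x hx hxr]
  · have hn : 0 < ‖x - p‖ := hr.trans_le hxr
    set s := r / (2 * ‖x - p‖) with hs
    have hs0 : 0 < s := by positivity
    have hs1 : s ≤ 1 := (div_le_one (by positivity)).2 (by linarith)
    have hsn : s * ‖x - p‖ = r / 2 := by rw [hs]; field_simp
    have hz := hf.convexOn_toReal.1 hx hp hs0.le (sub_nonneg.2 hs1) (by ring)
    have hc := hf.convexOn_toReal.2 hx hp hs0.le (sub_nonneg.2 hs1) (by ring)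
    have hzn : ‖s • x + (1 - s) • p - p‖ < r := by
      rw [show s • x + (1 - s) • p - p = s • (x - p) by module, norm_smul,
        Real.norm_of_nonneg hs0.le, hsn]
      linarith
    have h1 := near _ hz hzn
    simp only [smul_eq_mul] at hc
    have h2 : s * (2 / r * ‖x - p‖) = 1 := by
      rw [mul_left_comm, hsn]
      field_simp
    have h3 : s * ((f p).toReal - 2 / r * ‖x - p‖) ≤ s * (f x).toReal := by
      rw [mul_sub, h2]
      linarith
    linarith [le_of_mul_le_mul_left h3 hs0]

/-! ### Regularized zeros of `∂f + T` -/

theorem mem_opAdd_ofFun {E : Type*} [NormedAddCommGroup E] {A : E → Set E} {T : E → E}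
    {x w : E} : w ∈ opAdd A (ofFun T) x ↔ w - T x ∈ A x := by
  simp only [opAdd, ofFun, Set.add_singleton, image_add_right, mem_preimage, sub_eq_add_neg]

variable {T : E → E}

/-- For finitely many test points, the regularized variational inequality has a solution among
their convex combinations. -/
theorem IsGammaZero.exists_finite_minty (hf : IsGammaZero f) (hT : IsMonotone (ofFun T))
    {ε : ℝ} (hε : 0 ≤ ε) (s : Finset E) (hs : s.Nonempty) (hsf : ∀ y ∈ s, f y < ⊤) :
    ∃ x, f x < ⊤ ∧ ∀ y ∈ s, (f x).toReal + ε / 2 * ‖x‖ ^ 2 + inner ℝ (T y) (x - y) ≤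
      (f y).toReal + ε / 2 * ‖y‖ ^ 2 := by
  have : Nonempty s := hs.to_subtype
  set G : E → ℝ := fun x => (f x).toReal + ε / 2 * ‖x‖ ^ 2
  obtain ⟨w, hw, hwle⟩ := exists_mem_stdSimplex_forall_sum_le_zero
    (fun i j : s => inner ℝ (T i) (j.1 - i.1) + G j - G i) (fun i j => by
      have := hT.inner_nonneg i.1 j.1
      rw [inner_sub_right, real_inner_comm, real_inner_comm (T j)] at this
      rw [← neg_sub i.1, inner_neg_right]
      linarith)
  have hconv := hf.convexOn_add_sq hε
  refine ⟨∑ j, w j • j.1, hconv.1.sum_mem (fun i _ => hw.1 i) hw.2 (fun i _ => hsf _ i.2),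
    fun y hy => ?_⟩
  have h1 : G (∑ j, w j • j.1) ≤ ∑ j, w j * G j :=
    hconv.map_sum_le (fun i _ => hw.1 i) hw.2 (fun i _ => hsf _ i.2)
  have h2 := hwle ⟨y, hy⟩
  have h3 : ∑ j : s, w j * (inner ℝ (T y) (j.1 - y) + G j - G y) =
      inner ℝ (T y) (∑ j, w j • j.1 - y) + ∑ j, w j * G j - G y := by
    simp only [inner_sub_right, inner_sum, real_inner_smul_right, mul_sub, mul_add,
      Finset.sum_sub_distrib, Finset.sum_add_distrib, ← Finset.sum_mul, hw.2, one_mul]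
  simp only [h3] at h2
  change G _ + _ ≤ G y
  linarith

variable [CompleteSpace E]

/-- Minty's lemma: a solution of the variational inequality in which `T` is evaluated at the test
point solves the one in which `T` is evaluated at the solution. The quadratic term turns into
`ε x` by differentiation along segments. -/
theorem IsGammaZero.neg_smul_mem_of_minty (hf : IsGammaZero f)
    (hT : IsMaximallyMonotone (ofFun T)) {ε : ℝ} {x : E} (hx : f x < ⊤)
    (h : ∀ y, f y < ⊤ → (f x).toReal + ε / 2 * ‖x‖ ^ 2 + inner ℝ (T y) (x - y) ≤
      (f y).toReal + ε / 2 * ‖y‖ ^ 2) :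
    -(ε • x) ∈ opAdd (subdiff f) (ofFun T) x := by
  rw [mem_opAdd_ofFun, hf.mem_subdiff_iff]
  refine ⟨hx, fun y hy => ?_⟩
  have key : (f x).toReal - (f y).toReal - ε * inner ℝ x (y - x) ≤ inner ℝ (T x) (y - x) := by
    refine hT.le_inner_of_segment (k := ε / 2 * ‖y - x‖ ^ 2) fun t ht => ?_
    have hc := hf.convexOn_toReal
    have hmem := hc.1 hx hy (sub_nonneg.2 ht.2) ht.1.le (by ring)
    have hle := hc.2 hx hy (sub_nonneg.2 ht.2) ht.1.le (by ring)
    rw [show (1 - t) • x + t • y = x + t • (y - x) by module] at hmem hle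
    have h1 := h _ hmem
    rw [show x - (x + t • (y - x)) = -(t • (y - x)) by abel, inner_neg_right,
      real_inner_smul_right, norm_add_sq_real, real_inner_smul_right, norm_smul,
      Real.norm_of_nonneg ht.1.le] at h1
    simp only [smul_eq_mul] at hle
    refine le_of_mul_le_mul_left ?_ ht.1
    nlinarith
  rw [inner_sub_right, inner_neg_right, real_inner_smul_right, real_inner_comm,
    real_inner_comm (T x)]
  linarith

/-- Minty's surjectivity theorem for `∂f + T`, at the value `0`: every regularization
`∂f + T + ε Id` has a zero. The solutions for finite sets of test points are bounded because the
quadratic term dominates, and a weak cluster point along the directed set of finite test sets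
satisfies the inequality for every test point. -/
theorem IsGammaZero.exists_regularized_zero (hf : IsGammaZero f)
    (hT : IsMaximallyMonotone (ofFun T)) {ε : ℝ} (hε : 0 < ε) :
    ∃ x, -(ε • x) ∈ opAdd (subdiff f) (ofFun T) x := by
  classical
  obtain ⟨p, hp⟩ := hf.proper
  have hfin : ∀ s : Finset {y // f y < ⊤}, ∃ x, f x < ⊤ ∧ ∀ y : {y // f y < ⊤},
      y ∈ insert ⟨p, hp⟩ s → (f x).toReal + ε / 2 * ‖x‖ ^ 2 + inner ℝ (T y) (x - y) ≤
        (f y).toReal + ε / 2 * ‖y.1‖ ^ 2 := by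
    intro s
    obtain ⟨x, hx, h⟩ := hf.exists_finite_minty hT.1 hε.le
      ((insert ⟨p, hp⟩ s : Finset {y // f y < ⊤}).image Subtype.val)
      ((Finset.insert_nonempty _ _).image _) (fun y hy => by
        obtain ⟨z, -, rfl⟩ := Finset.mem_image.1 hy
        exact z.2)
    exact ⟨x, hx, fun y hy => h y (Finset.mem_image_of_mem _ hy)⟩
  choose x hx hxle using hfin
  obtain ⟨K, hK, hlow⟩ := hf.exists_linear_lower_bound hp
  -- the test point `p` gives `ε / 2 * n ^ 2 ≤ a + b * n` for the norm `n` of `x s`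
  set b := K + ‖T p‖ with hb
  set a := ε / 2 * ‖p‖ ^ 2 + 1 + b * ‖p‖ with ha
  have hbd : ∀ s, ‖x s‖ ≤ 1 + 2 * (a + b) / ε := by
    intro s
    have h1 := hxle s ⟨p, hp⟩ (Finset.mem_insert_self _ _)
    have h2 := hlow _ (hx s)
    have h3 := (abs_le.1 (abs_real_inner_le_norm (T p) (x s - p))).1
    have h4 : b * ‖x s - p‖ ≤ b * (‖x s‖ + ‖p‖) :=
      mul_le_mul_of_nonneg_left (norm_sub_le _ _) (by positivity)
    have h5 : ε / 2 * ‖x s‖ ^ 2 ≤ a + b * ‖x s‖ := by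
      simp only at h1
      rw [ha]
      rw [hb] at h4 ⊢
      linarith
    by_contra! hlt
    have ha0 : 0 ≤ a := by positivity
    have hb0 : 0 ≤ b := by positivity
    have h6 : 1 ≤ ‖x s‖ := by
      have : 0 ≤ 2 * (a + b) / ε := by positivity
      linarith
    have h7 : a + b < ε / 2 * ‖x s‖ := by
      have : 2 * (a + b) / ε < ‖x s‖ := by linarith
      rw [div_lt_iff₀ hε] at this
      linarith
    nlinarith
  obtain ⟨u, hu⟩ := exists_forall_mem_of_eventually_norm_le (l := atTop) (x := x)
    (Eventually.of_forall hbd)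
  have hmem : ∀ y : {y // f y < ⊤}, f u < ⊤ ∧
      (f u).toReal + ε / 2 * ‖u‖ ^ 2 + inner ℝ (T y) u ≤
        (f y).toReal + ε / 2 * ‖y.1‖ ^ 2 + inner ℝ (T y) y.1 := by
    intro y
    refine hu _ (hf.convex_sublevel hε.le _ _) (hf.isClosed_sublevel _ _ _) ?_
    filter_upwards [eventually_ge_atTop {y}] with s hs
    have := hxle s y (Finset.mem_insert_of_mem (hs (Finset.mem_singleton_self y)))
    rw [inner_sub_right] at this
    exact ⟨hx s, by linarith⟩
  refine ⟨u, hf.neg_smul_mem_of_minty hT (hmem ⟨p, hp⟩).1 fun y hy => ?_⟩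
  have := (hmem ⟨y, hy⟩).2
  rw [inner_sub_right]
  linarith

/-- If the regularized zeros stay bounded, a weak cluster point as `ε ↓ 0` is a zero. -/
theorem IsGammaZero.nonempty_opZer_of_bounded (hf : IsGammaZero f)
    (hT : IsMaximallyMonotone (ofFun T)) {M : ℝ}
    (hM : ∀ ε ∈ Ioc (0 : ℝ) 1, ∀ x, -(ε • x) ∈ opAdd (subdiff f) (ofFun T) x → ‖x‖ ≤ M) :
    (opZer (opAdd (subdiff f) (ofFun T))).Nonempty := by
  have hex : ∀ ε : ℝ, ∃ x, 0 < ε → -(ε • x) ∈ opAdd (subdiff f) (ofFun T) x := fun ε => by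
    by_cases hε : 0 < ε
    · obtain ⟨x, hx⟩ := hf.exists_regularized_zero hT hε
      exact ⟨x, fun _ => hx⟩
    · exact ⟨0, fun h => absurd h hε⟩
  choose x hx using hex
  have hxM : ∀ ε ∈ Ioc (0 : ℝ) 1, ‖x ε‖ ≤ M := fun ε hε => hM ε hε _ (hx ε hε.1)
  have hM0 : 0 ≤ M := (norm_nonneg _).trans (hxM 1 ⟨one_pos, le_rfl⟩)
  obtain ⟨u, hu⟩ := exists_forall_mem_of_eventually_norm_le (l := 𝓝[>] (0 : ℝ)) (x := x)
    (by filter_upwards [Ioc_mem_nhdsGT one_pos] with ε hε using hxM ε hε)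
  have hmem : ∀ y, f y < ⊤ → ∀ δ > 0, f u < ⊤ ∧ (f u).toReal + 0 / 2 * ‖u‖ ^ 2 +
      inner ℝ (T y) u ≤ (f y).toReal + inner ℝ (T y) y + δ := by
    intro y hy δ hδ
    refine hu _ (hf.convex_sublevel le_rfl _ _) (hf.isClosed_sublevel _ _ _) ?_
    have hδ' : 0 < δ / (M * ‖y‖ + 1) := by positivity
    filter_upwards [Ioc_mem_nhdsGT (lt_min hδ' one_pos)] with ε hε
    have hε1 : ε ∈ Ioc (0 : ℝ) 1 := ⟨hε.1, hε.2.trans (min_le_right _ _)⟩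
    have h1 := hx ε hε.1
    rw [mem_opAdd_ofFun, hf.mem_subdiff_iff] at h1
    refine ⟨h1.1, ?_⟩
    have h2 := h1.2 y hy
    have h3 := hT.1.inner_nonneg (x ε) y
    rw [inner_sub_right, inner_neg_right, real_inner_smul_right, inner_sub_left,
      inner_sub_left, real_inner_self_eq_norm_sq] at h2
    rw [inner_sub_right, inner_sub_left, inner_sub_left, real_inner_comm (T y),
      real_inner_comm (T y) y] at h3
    have h4 : inner ℝ y (x ε) ≤ M * ‖y‖ + 1 := by
      have h5 := real_inner_le_norm y (x ε)
      have h6 := mul_le_mul_of_nonneg_left (hxM ε hε1) (norm_nonneg y)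
      linarith
    have h7 := mul_le_mul_of_nonneg_left h4 hε.1.le
    have h8 : ε * (M * ‖y‖ + 1) ≤ δ :=
      (le_div_iff₀ (by positivity)).1 (hε.2.trans (min_le_left _ _))
    have h9 := mul_nonneg hε.1.le (sq_nonneg ‖x ε‖)
    linarith
  obtain ⟨p, hp⟩ := hf.proper
  refine ⟨u, ?_⟩
  have := hf.neg_smul_mem_of_minty hT (ε := 0) (hmem p hp 1 one_pos).1 fun y hy =>
    le_of_forall_pos_le_add fun δ hδ => by
      have := (hmem y hy δ hδ).2
      rw [inner_sub_right]
      linarith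
  rwa [zero_smul, neg_zero] at this

end

section

/-! ### Uniform monotonicity and `3*` monotonicity -/

variable {E : Type*} [NormedAddCommGroup E] [InnerProductSpace ℝ E] {f : E → EReal} {T : E → E}
  {A : E → Set E} {φ : ℝ≥0 → ℝ≥0∞}

theorem IsMonotone.opAdd_ofFun (hA : IsMonotone A) (hT : IsMonotone (ofFun T)) :
    IsMonotone (opAdd A (ofFun T)) := by
  intro x y u hu v hv
  have h1 := hA x y _ (mem_opAdd_ofFun.1 hu) _ (mem_opAdd_ofFun.1 hv)
  have h2 := hT.inner_nonneg x y
  rw [show u - v = (u - T x - (v - T y)) + (T x - T y) by abel, inner_add_right]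
  exact add_nonneg h1 h2

theorem IsUniformlyMonotoneWith.opAdd_ofFun (hA : IsUniformlyMonotoneWith φ A)
    (hT : IsMonotone (ofFun T)) : IsUniformlyMonotoneWith φ (opAdd A (ofFun T)) := by
  refine ⟨hA.1, fun x y u hu v hv => (hA.2 x y _ (mem_opAdd_ofFun.1 hu) _
    (mem_opAdd_ofFun.1 hv)).trans ?_⟩
  rw [EReal.coe_le_coe_iff]
  have h2 := hT.inner_nonneg x y
  rw [show u - v = (u - T x - (v - T y)) + (T x - T y) by abel, inner_add_right]
  linarith

theorem IsMonotone.opAdd_ofFun_of_isUniformlyMonotoneWith (hA : IsMonotone A)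
    (hT : IsUniformlyMonotoneWith φ (ofFun T)) :
    IsUniformlyMonotoneWith φ (opAdd A (ofFun T)) := by
  refine ⟨hT.1, fun x y u hu v hv => (hT.2 x y _ rfl _ rfl).trans ?_⟩
  rw [EReal.coe_le_coe_iff]
  have h1 := hA x y _ (mem_opAdd_ofFun.1 hu) _ (mem_opAdd_ofFun.1 hv)
  rw [show u - v = (u - T x - (v - T y)) + (T x - T y) by abel, inner_add_right]
  linarith

/-- The subdifferential of a uniformly convex function is uniformly monotone with the same modulus:
add the two subgradient inequalities evaluated at the midpoint. -/
theorem IsGammaZero.isUniformlyMonotoneWith_subdiff (hf : IsGammaZero f)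
    (hφ : IsUniformlyConvexWith φ f) : IsUniformlyMonotoneWith φ (subdiff f) := by
  refine ⟨hφ.1, fun x y u hu v hv => ?_⟩
  have hu' := hf.mem_subdiff_iff.1 hu
  have hv' := hf.mem_subdiff_iff.1 hv
  have hmid := hf.convexOn_toReal.1 hu'.1 hv'.1 (by norm_num : (0 : ℝ) ≤ 1 / 2)
    (by norm_num : (0 : ℝ) ≤ 1 - 1 / 2) (by norm_num)
  have h := hφ.2 x y hu'.1 hv'.1 (1 / 2) (by norm_num) (by norm_num)
  have h1 := hu'.2 _ hmid
  have h2 := hv'.2 _ hmid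
  rw [show (1 / 2 : ℝ) • x + (1 - 1 / 2 : ℝ) • y - x = (-(1 / 2) : ℝ) • (x - y) by module,
    real_inner_smul_left] at h1
  rw [show (1 / 2 : ℝ) • x + (1 - 1 / 2 : ℝ) • y - y = (1 / 2 : ℝ) • (x - y) by module,
    real_inner_smul_left] at h2
  rw [← hf.coe_toReal hu'.1, ← hf.coe_toReal hv'.1, ← hf.coe_toReal hmid] at h
  set Fm := (f ((1 / 2 : ℝ) • x + (1 - 1 / 2 : ℝ) • y)).toReal
  have hfin : φ ‖x - y‖₊ ≠ ⊤ := by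
    intro htop
    rw [htop, EReal.coe_ennreal_top, EReal.coe_mul_top_of_pos (by norm_num),
      EReal.coe_add_top, top_le_iff] at h
    exact EReal.coe_ne_top _ (by exact_mod_cast h)
  lift φ ‖x - y‖₊ to ℝ≥0 using hfin with c
  rw [show ((c : ℝ≥0∞) : EReal) = ((c : ℝ) : EReal) from rfl] at h ⊢
  rw [EReal.coe_le_coe_iff, inner_sub_right]
  have h3 : Fm + 1 / 2 * (1 - 1 / 2) * (c : ℝ) ≤
      1 / 2 * (f x).toReal + (1 - 1 / 2) * (f y).toReal := by exact_mod_cast h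
  linarith

theorem IsSupercoercive.exists_mul_lt (hφ : IsSupercoercive φ) (c : ℝ≥0) :
    ∃ R : ℝ≥0, ∀ t, R ≤ t → ((c * t : ℝ≥0) : ℝ≥0∞) < φ t := by
  have h := ((tendsto_order.1 hφ).1 _ (ENNReal.coe_lt_top (r := c))).and (eventually_ge_atTop 1)
  obtain ⟨R, hR⟩ := eventually_atTop.1 h
  refine ⟨R, fun t ht => ?_⟩
  obtain ⟨h1, h2⟩ := hR t ht
  have ht0 : (t : ℝ≥0∞) ≠ 0 := by
    exact_mod_cast (one_pos.trans_le h2).ne'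
  rw [ENNReal.coe_mul]
  exact (ENNReal.lt_div_iff_mul_lt (Or.inl ht0) (Or.inl ENNReal.coe_ne_top)).1 h1

/-- If `A` is uniformly monotone with a supercoercive modulus, points of the graph with bounded
values are bounded. -/
theorem IsUniformlyMonotoneWith.exists_norm_le (hA : IsUniformlyMonotoneWith φ A)
    (hφ : IsSupercoercive φ) {p q : E} (hp : q ∈ A p) (N : ℝ) :
    ∃ M : ℝ, ∀ x, ∀ u ∈ A x, ‖u‖ ≤ N → ‖x‖ ≤ M := by
  obtain ⟨R, hR⟩ := hφ.exists_mul_lt (N + ‖q‖).toNNReal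
  refine ⟨R + ‖p‖, fun x u hu huN => ?_⟩
  by_contra! hlt
  have hxR : R ≤ ‖x - p‖₊ := by
    have h : (R : ℝ) ≤ ‖x - p‖ := by linarith [norm_sub_norm_le x p]
    exact_mod_cast h
  have h1 := EReal.coe_ennreal_lt_coe_ennreal_iff.2 (hR _ hxR)
  have h2 := h1.trans_le (hA.2 x p u hu q hp)
  rw [show ((((N + ‖q‖).toNNReal * ‖x - p‖₊ : ℝ≥0) : ℝ≥0∞) : EReal) =
    ((((N + ‖q‖).toNNReal * ‖x - p‖₊ : ℝ≥0) : ℝ) : EReal) from rfl, EReal.coe_lt_coe_iff,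
    NNReal.coe_mul, coe_nnnorm] at h2
  have h3 := mul_le_mul_of_nonneg_right (Real.le_coe_toNNReal (N + ‖q‖)) (norm_nonneg (x - p))
  have h4 := real_inner_le_norm (x - p) (u - q)
  have h5 := mul_le_mul_of_nonneg_left ((norm_sub_le u q).trans
    (add_le_add_left huN ‖q‖)) (norm_nonneg (x - p))
  linarith

theorem IsUniformlyMonotoneWith.subsingleton_opZer (hA : IsUniformlyMonotoneWith φ A) :
    (opZer A).Subsingleton := by
  intro x hx y hy
  have h := hA.2 x y 0 hx 0 hy
  rw [sub_zero, inner_zero_right, EReal.coe_zero, ← EReal.coe_ennreal_zero,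
    EReal.coe_ennreal_le_coe_ennreal_iff, nonpos_iff_eq_zero, hA.1.2, nnnorm_eq_zero, sub_eq_zero] at h
  exact h

theorem IsThreeStarMonotone.exists_le_inner (hA : IsThreeStarMonotone A) {x u : E}
    (hx : x ∈ opDom A) (hu : u ∈ opRan A) :
    ∃ c : ℝ, ∀ y, ∀ v ∈ A y, c ≤ inner ℝ (x - y) (u - v) := by
  have h := hA.2 x hx u hu
  have hbot : (⨅ p ∈ opGraph A, ((inner ℝ (x - p.1) (u - p.2) : ℝ) : EReal)) ≠ ⊥ := by
    intro hbot
    rw [fitzpatrick, hbot, EReal.coe_sub_bot] at h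
    exact lt_irrefl _ h
  obtain ⟨c, hc⟩ := EReal.lt_iff_exists_real_btwn.1 (bot_lt_iff_ne_bot.2 hbot)
  refine ⟨c, fun y v hv => ?_⟩
  have h1 := hc.2.le.trans (iInf₂_le (y, v) hv)
  exact_mod_cast h1

/-- The graph of a subdifferential satisfies the `3*` bound, even with a first component that is
only in the domain of the function. -/
theorem IsGammaZero.exists_le_inner_subdiff (hf : IsGammaZero f) {x u : E} (hx : f x < ⊤)
    (hu : u ∈ opRan (subdiff f)) :
    ∃ c : ℝ, ∀ y, ∀ v ∈ subdiff f y, c ≤ inner ℝ (x - y) (u - v) := by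
  obtain ⟨z, hz⟩ := hu
  rw [hf.mem_subdiff_iff] at hz
  refine ⟨inner ℝ (x - z) u + (f z).toReal - (f x).toReal, fun y v hv => ?_⟩
  rw [hf.mem_subdiff_iff] at hv
  have h1 := hv.2 x hx
  have h2 := hz.2 y hv.1
  rw [inner_sub_right]
  rw [inner_sub_left] at h2 ⊢
  rw [inner_sub_left x y u]
  linarith

/-- Cocoercivity supplies the square `β ‖T z - T y‖ ^ 2`, which absorbs the cross term
`⟪x - z, T z - T y⟫`. -/
theorem IsCocoercive.isThreeStarMonotone {β : ℝ} (hβ : 0 < β) (hT : IsCocoercive β T) :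
    IsThreeStarMonotone (ofFun T) := by
  refine ⟨?_, ?_⟩
  · rintro x y _ rfl _ rfl
    exact (by positivity : 0 ≤ β * ‖T x - T y‖ ^ 2).trans (hT x y)
  · rintro x - u ⟨z, rfl⟩
    have hle : ((-(‖x - z‖ ^ 2 / (4 * β)) : ℝ) : EReal) ≤
        ⨅ p ∈ opGraph (ofFun T), ((inner ℝ (x - p.1) (T z - p.2) : ℝ) : EReal) := by
      refine le_iInf₂ ?_
      rintro ⟨y, v⟩ hv
      obtain rfl : v = T y := hv
      rw [EReal.coe_le_coe_iff]
      have h1 := hT z y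
      have h2 := (abs_le.1 (abs_real_inner_le_norm (x - z) (T z - T y))).1
      rw [show x - y = (x - z) + (z - y) by abel, inner_add_left]
      have h3 : ‖x - z‖ * ‖T z - T y‖ ≤ ‖x - z‖ ^ 2 / (4 * β) + β * ‖T z - T y‖ ^ 2 := by
        have : ‖x - z‖ ^ 2 / (4 * β) + β * ‖T z - T y‖ ^ 2 - ‖x - z‖ * ‖T z - T y‖ =
            (‖x - z‖ - 2 * β * ‖T z - T y‖) ^ 2 / (4 * β) := by
          field_simp
          ring
        have h4 : 0 ≤ (‖x - z‖ - 2 * β * ‖T z - T y‖) ^ 2 / (4 * β) := by positivity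
        linarith
      linarith
    rw [fitzpatrick]
    refine lt_of_le_of_lt (EReal.sub_le_sub le_rfl hle) ?_
    rw [← EReal.coe_sub]
    exact EReal.coe_lt_top _

/-! ### Existence of zeros of `∂f + T` -/

theorem IsMonotone.norm_smul_le_of_mem (hA : IsMonotone A) {p x : E} {ε : ℝ}
    (hp : -p ∈ A p) (hε : ε ∈ Ioc (0 : ℝ) 1) (hx : -(ε • x) ∈ A x) : ‖ε • x‖ ≤ 2 * ‖p‖ := by
  rw [norm_smul, Real.norm_of_nonneg hε.1.le]
  have h := hA x p _ hx _ hp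
  rw [inner_sub_right, inner_sub_left, inner_sub_left] at h
  simp only [inner_neg_right, real_inner_smul_right, real_inner_self_eq_norm_sq] at h
  rw [real_inner_comm x p] at h
  have h1 : ε * ‖x‖ ^ 2 ≤ 2 * (‖x‖ * ‖p‖) := by
    have h2 := (real_inner_le_norm x p)
    have h3 : 0 ≤ ‖x‖ * ‖p‖ := by positivity
    have h4 : ε * inner ℝ x p ≤ ‖x‖ * ‖p‖ :=
      (mul_le_mul_of_nonneg_left h2 hε.1.le).trans (mul_le_of_le_one_left h3 hε.2)
    linarith [sq_nonneg ‖p‖]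
  rcases (norm_nonneg x).eq_or_lt with h0 | h0
  · rw [← h0, mul_zero]
    positivity
  · refine le_of_mul_le_mul_right ?_ h0
    linarith

variable [CompleteSpace E]

/-- The sum `∂f + T` has a zero as soon as the points of its graph with bounded values are bounded:
the values `-ε x` at the regularized zeros `x` are bounded by monotonicity. -/
theorem IsGammaZero.nonempty_opZer_of_forall_norm_le (hf : IsGammaZero f)
    (hT : IsMaximallyMonotone (ofFun T))
    (h : ∀ N : ℝ, ∃ M : ℝ, ∀ x, ∀ u ∈ opAdd (subdiff f) (ofFun T) x, ‖u‖ ≤ N → ‖x‖ ≤ M) :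
    (opZer (opAdd (subdiff f) (ofFun T))).Nonempty := by
  obtain ⟨p, hp⟩ := hf.exists_regularized_zero hT one_pos
  rw [one_smul] at hp
  obtain ⟨M, hM⟩ := h (2 * ‖p‖)
  refine hf.nonempty_opZer_of_bounded hT (M := M) fun ε hε x hx => hM x _ hx ?_
  rw [norm_neg]
  exact (hf.isMonotone_subdiff.opAdd_ofFun hT.1).norm_smul_le_of_mem hp hε hx

theorem IsGammaZero.nonempty_opZer_of_isCoerciveOp (hf : IsGammaZero f)
    (hT : IsMaximallyMonotone (ofFun T))
    (h : IsCoerciveOp (opAdd (subdiff f) (ofFun T))) :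
    (opZer (opAdd (subdiff f) (ofFun T))).Nonempty := by
  refine hf.nonempty_opZer_of_forall_norm_le hT fun N => ?_
  have h1 : ∀ᶠ x in comap (fun x : E => ‖x‖) atTop,
      ENNReal.ofReal N < infNorm (opAdd (subdiff f) (ofFun T) x) :=
    (tendsto_order.1 h).1 _ ENNReal.ofReal_lt_top
  obtain ⟨M, hM⟩ := eventually_atTop.1 (eventually_comap.1 h1)
  refine ⟨M, fun x u hu huN => ?_⟩
  by_contra! hlt
  have h2 := (hM ‖x‖ hlt.le x rfl).trans_le (iInf₂_le u hu)
  rw [← ofReal_norm] at h2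
  exact absurd (ENNReal.ofReal_le_ofReal huN) (not_le.2 h2)

theorem IsGammaZero.nonempty_opZer_of_isUniformlyMonotoneWith (hf : IsGammaZero f)
    (hT : IsMaximallyMonotone (ofFun T)) (hφ : IsSupercoercive φ)
    (h : IsUniformlyMonotoneWith φ (opAdd (subdiff f) (ofFun T))) :
    (opZer (opAdd (subdiff f) (ofFun T))).Nonempty := by
  obtain ⟨p, hp⟩ := hf.exists_regularized_zero hT one_pos
  exact hf.nonempty_opZer_of_forall_norm_le hT fun N => h.exists_norm_le hφ hp N

theorem IsGammaZero.nonempty_opZer_of_isBounded (hf : IsGammaZero f)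
    (hT : IsMaximallyMonotone (ofFun T)) (h : Bornology.IsBounded (opDom (subdiff f))) :
    (opZer (opAdd (subdiff f) (ofFun T))).Nonempty := by
  obtain ⟨M, hM⟩ := h.exists_norm_le
  exact hf.nonempty_opZer_of_bounded hT fun ε _ x hx => hM x ⟨_, mem_opAdd_ofFun.1 hx⟩

/-- The Brezis–Haraux argument. Every `w` splits as `a + b` with `a` in the range of `∂f` and `b`
in the range of `T`; adding the two `3*` bounds at a common point of the domains bounds `⟪x, w⟫`
over all regularized zeros `x`, and uniform boundedness applies. -/
theorem IsGammaZero.nonempty_opZer_of_isThreeStarMonotone (hf : IsGammaZero f)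
    (hT : IsMaximallyMonotone (ofFun T)) (h3 : IsThreeStarMonotone (ofFun T))
    (hsurj : IsSurjective (subdiff f) ∨ IsSurjective (ofFun T)) :
    (opZer (opAdd (subdiff f) (ofFun T))).Nonempty := by
  obtain ⟨p, hp⟩ := hf.exists_regularized_zero hT one_pos
  rw [one_smul] at hp
  have hp' := mem_opAdd_ofFun.1 hp
  have hpf := (hf.mem_subdiff_iff.1 hp').1
  have hsplit : ∀ w : E, ∃ a ∈ opRan (subdiff f), ∃ b ∈ opRan (ofFun T), a + b = w := by
    intro w
    rcases hsurj with hs | hs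
    · exact ⟨w - T p, by rw [hs]; trivial, T p, ⟨p, rfl⟩, sub_add_cancel _ _⟩
    · exact ⟨-p - T p, ⟨p, hp'⟩, w - (-p - T p), by rw [hs]; trivial, add_sub_cancel _ _⟩
  obtain ⟨M, hM⟩ := exists_forall_norm_le_of_forall_inner_le
    (ι := {q : ℝ × E // q.1 ∈ Ioc (0 : ℝ) 1 ∧
      -(q.1 • q.2) ∈ opAdd (subdiff f) (ofFun T) q.2}) (a := fun q => q.1.2) (fun w => by
    obtain ⟨a, ha, b, hb, rfl⟩ := hsplit w
    obtain ⟨c, hc⟩ := hf.exists_le_inner_subdiff hpf ha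
    obtain ⟨d, hd⟩ := h3.exists_le_inner (x := p) ⟨T p, rfl⟩ hb
    refine ⟨inner ℝ p (a + b) + ‖p‖ * (2 * ‖p‖) - c - d, ?_⟩
    rintro ⟨⟨ε, x⟩, hε, hx⟩
    simp only at hε hx ⊢
    have h1 := hc x _ (mem_opAdd_ofFun.1 hx)
    have h2 := hd x _ rfl
    have h4 : c + d ≤ inner ℝ (p - x) (a + b + ε • x) := by
      refine (add_le_add h1 h2).trans_eq ?_
      rw [← inner_add_right]
      congr 1
      abel
    have h5 := (hf.isMonotone_subdiff.opAdd_ofFun hT.1).norm_smul_le_of_mem hp hε hx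
    have h6 := (real_inner_le_norm p (ε • x)).trans
      (mul_le_mul_of_nonneg_left h5 (norm_nonneg p))
    rw [inner_add_right, inner_sub_left, inner_sub_left, real_inner_smul_right x x,
      real_inner_self_eq_norm_sq] at h4
    have h7 := mul_nonneg hε.1.le (sq_nonneg ‖x‖)
    linarith)
  exact hf.nonempty_opZer_of_bounded hT fun ε hε x hx => hM ⟨(ε, x), hε, hx⟩

end

end NashMonotone

open NashMonotone
theorem proposition3p2 {m : ℕ} (hm : 2 ≤ m) {H : Fin m → Type*}
    [∀ i, NormedAddCommGroup (H i)] [∀ i, InnerProductSpace ℝ (H i)]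
    [∀ i, CompleteSpace (H i)]
    (f : PiLp 2 H → EReal) (hf : IsGammaZero f)
    (g : Fin m → PiLp 2 H → ℝ)
    (hg_convex : ∀ (i : Fin m) (x : PiLp 2 H), ConvexOn ℝ univ (slice (g i) i x))
    (hg_diff : ∀ (i : Fin m) (x : PiLp 2 H) (y : H i), IsDiffAt (slice (g i) i x) y)
    (hg_mono : ∀ x y : PiLp 2 H,
      0 ≤ ∑ i, inner ℝ (partialGrad (g i) i x - partialGrad (g i) i y) (x i - y i))
    (hB : IsMaximallyMonotone (ofFun (pseudoGrad g))) :
    (((IsCoerciveOp (opAdd (subdiff f) (ofFun (pseudoGrad g)))) ∨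
      (∃ φ, IsSupercoercive φ ∧
        IsUniformlyMonotoneWith φ (opAdd (subdiff f) (ofFun (pseudoGrad g)))) ∨
      (Bornology.IsBounded (opDom (subdiff f) ∩ opDom (ofFun (pseudoGrad g)))) ∨
      (∃ C : Set (PiLp 2 H), C.Nonempty ∧ IsClosed C ∧ Convex ℝ C ∧
        Bornology.IsBounded C ∧ f = indicatorFun C) ∨
      (∃ φ, IsSupercoercive φ ∧ IsUniformlyConvexWith φ f) ∨
      (IsThreeStarMonotone (ofFun (pseudoGrad g)) ∧
        (IsSurjective (subdiff f) ∨ IsSurjective (ofFun (pseudoGrad g)))) ∨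
      (∃ φ, IsSupercoercive φ ∧ IsUniformlyMonotoneWith φ (ofFun (pseudoGrad g))) ∨
      ((∃ L : PiLp 2 H →L[ℝ] PiLp 2 H, ∀ x, pseudoGrad g x = L x) ∧
        (∃ β : ℝ, 0 < β ∧ IsCocoercive β (pseudoGrad g)) ∧
        (IsSurjective (subdiff f) ∨ IsSurjective (ofFun (pseudoGrad g))))) →
      (opZer (opAdd (subdiff f) (ofFun (pseudoGrad g)))).Nonempty) ∧
    (((∃ φ, IsSupercoercive φ ∧
        IsUniformlyMonotoneWith φ (opAdd (subdiff f) (ofFun (pseudoGrad g)))) ∨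
      (∃ φ, IsSupercoercive φ ∧ IsUniformlyConvexWith φ f) ∨
      (∃ φ, IsSupercoercive φ ∧ IsUniformlyMonotoneWith φ (ofFun (pseudoGrad g)))) →
      ∃ x, opZer (opAdd (subdiff f) (ofFun (pseudoGrad g))) = {x}) := by
  set T := pseudoGrad g
  have hdom : opDom (ofFun T) = univ := eq_univ_of_forall fun x => ⟨T x, rfl⟩
  have h5 : ∀ {φ}, IsUniformlyConvexWith φ f →
      IsUniformlyMonotoneWith φ (opAdd (subdiff f) (ofFun T)) := fun h =>
    (hf.isUniformlyMonotoneWith_subdiff h).opAdd_ofFun hB.1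
  have h7 : ∀ {φ}, IsUniformlyMonotoneWith φ (ofFun T) →
      IsUniformlyMonotoneWith φ (opAdd (subdiff f) (ofFun T)) := fun h =>
    hf.isMonotone_subdiff.opAdd_ofFun_of_isUniformlyMonotoneWith h
  constructor
  · rintro (h | ⟨φ, hφ, h⟩ | h | ⟨C, -, -, -, hC, rfl⟩ | ⟨φ, hφ, h⟩ | ⟨h, hs⟩ | ⟨φ, hφ, h⟩ |
      ⟨-, ⟨β, hβ, h⟩, hs⟩)
    · exact hf.nonempty_opZer_of_isCoerciveOp hB h
    · exact hf.nonempty_opZer_of_isUniformlyMonotoneWith hB hφ h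
    · rw [hdom, inter_univ] at h
      exact hf.nonempty_opZer_of_isBounded hB h
    · refine hf.nonempty_opZer_of_isBounded hB (hC.subset ?_)
      rintro x ⟨u, hu⟩
      by_contra hx
      have := (hf.mem_subdiff_iff.1 hu).1
      simp [indicatorFun, hx] at this
    · exact hf.nonempty_opZer_of_isUniformlyMonotoneWith hB hφ (h5 h)
    · exact hf.nonempty_opZer_of_isThreeStarMonotone hB h hs
    · exact hf.nonempty_opZer_of_isUniformlyMonotoneWith hB hφ (h7 h)
    · exact hf.nonempty_opZer_of_isThreeStarMonotone hB (h.isThreeStarMonotone hβ) hs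
  · intro h
    obtain ⟨φ, hφ, h⟩ : ∃ φ, IsSupercoercive φ ∧
        IsUniformlyMonotoneWith φ (opAdd (subdiff f) (ofFun T)) := by
      rcases h with h | ⟨φ, hφ, h⟩ | ⟨φ, hφ, h⟩
      exacts [h, ⟨φ, hφ, h5 h⟩, ⟨φ, hφ, h7 h⟩]
    exact exists_eq_singleton_iff_nonempty_subsingleton.2
      ⟨hf.nonempty_opZer_of_isUniformlyMonotoneWith hB hφ h, h.subsingleton_opZer⟩
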